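/- Let $d\in\{-2,-7,-11,-15\}$, let $R=\mathcal{O}_{\mathbb{Q}(\sqrt d)}$, let $\mathcal{L}_n=\{x\in R : x\overline{x}=n\}$ and $\mathcal{L}=\{0\}\cup\mathcal{L}_1\cup\mathcal{L}_2\cup\mathcal{L}_3\cup\mathcal{L}_4$. An $\mathcal{L}$-graph $G$ on a finite vertex set is given by a Hermitian matrix $A$ whose off-diagonal entries lie in $\mathcal{L}$ and whose diagonal entries lie in $\{0,1,-1\}$: a non-zero entry $A_{uv}$ with $u\ne v$ is the label of an edge between $u$ and $v$, of weight $A_{uv}\overline{A_{uv}}$, and a vertex $v$ is charged if $A_{vv}=\pm1$. The weighted degree of a vertex is the sum of the weights of its edges, plus $1$ if it is charged. $G$ is $4$-cyclotomic if all eigenvalues of $A$ lie in $[-2,2]$ and every vertex has weighted degree $4$. Let $G$ be a connected $4$-cyclotomic $\mathcal{L}$-graph that has at least one edge of weight $2$, and suppose that the edges of weight $2$ occur in pairs, in the sense that every edge of weight $2$ shares a vertex with another edge of weight $2$. (This holds in particular if they occur in isolated pairs in the strict sense, i.e. if every connected component of the graph formed by the edges of weight $2$ is a path with two edges; it also allows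 the $4$-cycle of weight-$2$ edges that is $\mathcal{T}_4^4$.) Then, up to the naming of the vertices, the signs of the charges and the choice of the edge labels within a given weight, $G$ is one of the following: - for some $k\ge2$, the form $\mathcal{T}_{2k}^4$: the vertices are $a_1,\dots,a_{k-1},b_1,\dots,b_{k-1},y,z$, all uncharged; there are edges of weight $1$ joining each of $a_i,b_i$ to each of $a_{i+1},b_{i+1}$ for $1\le i<k-1$, edges of weight $2$ joining $y$ to $a_1$ and $b_1$ and joining $z$ to $a_{k-1}$ and $b_{k-1}$, and no other edges; - for some $k\ge1$, the form $\mathcal{C}_{2k}^{2\pm}$: the vertices are $a_1,\dots,a_k,b_1,\dots,b_k,z$, of which exactly $a_1$ and $b_1$ are charged; there are edges of weight $1$ joining $a_1$ to $b_1$ and joining each of $a_i,b_i$ to each of $a_{i+1},b_{i+1}$ for $1\le i<k$, edges of weight $2$ joining $z$ to $a_k$ and $b_k$, and no other edges. -/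

import Mathlib

/-- The ring of integers of `ℚ(√d)`, as a subring of `ℂ`: the elements of the field generated
over `ℚ` by the square roots of `d` that are integral over `ℤ`. -/
noncomputable def quadraticIntegers (d : ℤ) : Subring ℂ :=
  (IntermediateField.adjoin ℚ {z : ℂ | z ^ 2 = (d : ℂ)}).toSubfield.toSubring ⊓
    (integralClosure ℤ ℂ).toSubring

/-- `𝓛ₙ`: the elements of the ring of integers of `ℚ(√d)` with `x * conj x = n`. -/
def labelsOfNorm (d : ℤ) (n : ℕ) : Set ℂ :=
  {x : ℂ | x ∈ quadraticIntegers d ∧ x * star x = (n : ℂ)}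

/-- `𝓛 = {0} ∪ 𝓛₁ ∪ 𝓛₂ ∪ 𝓛₃ ∪ 𝓛₄`. -/
def labelSet (d : ℤ) : Set ℂ :=
  {0} ∪ labelsOfNorm d 1 ∪ labelsOfNorm d 2 ∪ labelsOfNorm d 3 ∪ labelsOfNorm d 4

/-- A (charged) `𝓛`-graph with vertex set `V`, given by its Hermitian adjacency matrix: the
off-diagonal entries are the edge labels (`0` for no edge), the diagonal entries the charges. -/
structure LGraph (d : ℤ) (V : Type*) where
  adj : Matrix V V ℂ
  isHermitian : adj.IsHermitian
  label_mem : ∀ u v : V, u ≠ v → adj u v ∈ labelSet d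
  charge_mem : ∀ v : V, adj v v = 0 ∨ adj v v = 1 ∨ adj v v = -1

/-- A form: a graph specified only up to the weights of its edges (`0` for no edge) and up to
which of its vertices carry a charge `±1`. -/
structure GraphForm (W : Type*) where
  weight : W → W → ℕ
  charged : W → Prop

namespace LGraph

variable {d : ℤ} {V : Type*}

/-- `u` and `v` are joined by an edge with label in `𝓛ₙ`, i.e. an edge of weight `n`. -/
def IsEdgeOfWeight (G : LGraph d V) (n : ℕ) (u v : V) : Prop :=
  u ≠ v ∧ G.adj u v ∈ labelsOfNorm d n

/-- The underlying simple graph. -/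
def toSimpleGraph (G : LGraph d V) : SimpleGraph V where
  Adj u v := u ≠ v ∧ G.adj u v ≠ 0
  symm := ⟨fun u v h => ⟨h.1.symm, fun h0 => h.2 (by rw [← G.isHermitian.apply u v, h0, star_zero])⟩⟩
  loopless := ⟨fun _ h => h.1 rfl⟩

/-- The graph is connected. -/
def Connected (G : LGraph d V) : Prop := G.toSimpleGraph.Connected

/-- All eigenvalues of the adjacency matrix lie in `[-2, 2]`. -/
def IsCyclotomic [Fintype V] [DecidableEq V] (G : LGraph d V) : Prop :=
  ∀ i : V, G.isHermitian.eigenvalues i ∈ Set.Icc (-2 : ℝ) 2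

open Classical in
/-- The weighted degree of `v`: the sum of the weights of the edges at `v`, plus `1` if `v` is
charged. -/
noncomputable def weightedDegree [Fintype V] (G : LGraph d V) (v : V) : ℝ :=
  (∑ u ∈ Finset.univ.filter (fun u => u ≠ v), Complex.normSq (G.adj v u)) +
    (if G.adj v v = 0 then 0 else 1)

/-- Cyclotomic, with every vertex of weighted degree four. -/
def IsFourCyclotomic [Fintype V] [DecidableEq V] (G : LGraph d V) : Prop :=
  G.IsCyclotomic ∧ ∀ v : V, G.weightedDegree v = 4

/-- The edges of weight 2 occur in pairs: every one of them shares a vertex with another one.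
This holds in particular if they occur in isolated pairs in the strictest sense (the weight 2
edges form disjoint two-edge paths); it also allows the four-cycle of weight 2 edges. -/
def WeightTwoEdgesInPairs (G : LGraph d V) : Prop :=
  ∀ u v : V, G.IsEdgeOfWeight 2 u v →
    ∃ w : V, w ≠ u ∧ w ≠ v ∧ (G.IsEdgeOfWeight 2 u w ∨ G.IsEdgeOfWeight 2 v w)

/-- `G` is of the form `F`: for some identification of the vertices, the edge weights of `G` are
those of `F` and the charged vertices of `G` are those of `F`. -/
def IsOfForm {W : Type*} (G : LGraph d V) (F : GraphForm W) : Prop :=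
  ∃ e : V ≃ W,
    (∀ u v : V, u ≠ v → Complex.normSq (G.adj u v) = (F.weight (e u) (e v) : ℝ)) ∧
    ∀ v : V, G.adj v v ≠ 0 ↔ F.charged (e v)

end LGraph

/-- The form `𝒯_{2k}⁴` (for `k ≥ 2`) on `2k` vertices. There are `k - 1` columns of two vertices;
all edges between consecutive columns have weight 1, and there are none inside a column. The two
end vertices `inr false`, `inr true` are joined by edges of weight 2 to both vertices of the first
and of the last column respectively. No vertex is charged. -/
def formT (k : ℕ) : GraphForm ((Fin (k - 1) × Bool) ⊕ Bool) where
  weight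
    | .inl (i, _), .inl (j, _) => if (i : ℕ) + 1 = j ∨ (j : ℕ) + 1 = i then 1 else 0
    | .inl (i, _), .inr false => if (i : ℕ) = 0 then 2 else 0
    | .inl (i, _), .inr true => if (i : ℕ) + 1 = k - 1 then 2 else 0
    | .inr false, .inl (i, _) => if (i : ℕ) = 0 then 2 else 0
    | .inr true, .inl (i, _) => if (i : ℕ) + 1 = k - 1 then 2 else 0
    | .inr _, .inr _ => 0
  charged _ := False

/-- The form `𝒞_{2k}^{2±}` (for `k ≥ 1`) on `2k + 1` vertices. There are `k` columns of two
vertices; all edges between consecutive columns have weight 1. The two vertices of the first column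
are charged and joined by an edge of weight 1; there are no other edges inside a column. The end
vertex `inr ()` is joined by edges of weight 2 to both vertices of the last column. -/
def formC (k : ℕ) : GraphForm ((Fin k × Bool) ⊕ Unit) where
  weight
    | .inl (i, s), .inl (j, t) =>
        if ((i : ℕ) + 1 = j ∨ (j : ℕ) + 1 = i) ∨ ((i : ℕ) = 0 ∧ (j : ℕ) = 0 ∧ s ≠ t) then 1 else 0
    | .inl (i, _), .inr _ => if (i : ℕ) + 1 = k then 2 else 0
    | .inr _, .inl (i, _) => if (i : ℕ) + 1 = k then 2 else 0
    | .inr _, .inr _ => 0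
  charged
    | .inl (i, _) => (i : ℕ) = 0
    | .inr _ => False

/-!
A Hermitian matrix `A` with spectrum in `[-2, 2]` all of whose rows have squared norm `4` satisfies
`A * A = 4`: the eigenvalues of `4 - A * A` are nonnegative and their sum, its trace, vanishes
(`LGraph.adj_mul_adj`). So distinct rows of `A` are orthogonal. The classification uses this only
through the weights `W u v = |A u v|²`, which are natural numbers: if exactly two terms of the inner
product `∑ w, A u w * A w x = 0` can be nonzero, namely those at `c` and `e`, and if
`W u c = W u e ≠ 0`, then `W c x = W e x`. This is the field `transfer` of `IsWeightSystem`, and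
together with connectedness and the row sums `4` it determines the graph.

Since weight 2 edges come in pairs, some vertex `z` carries two of them, which exhaust its degree.
Starting from `z`, the graph is a ladder of columns of two vertices (`IsLadder`). The two vertices
`c`, `e` of the last column have degree `2` left over, and by orthogonality with a vertex of the
preceding column (or with `z`) they have the same weights to every vertex outside the completed part
(`IsLadder.twin`). There are three ways to spend the remaining degree: `c` and `e` are charged and
joined to each other, which closes the graph as `formC`; both have a weight 2 edge to a
common new vertex, which closes it as `formT`; or both are joined by weight 1 edges to two new
vertices, which form another column (`IsLadder.cases_next`). As the vertex set is finite, the last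
case cannot recur forever.
-/

/-! ### Weight systems -/

/-- The combinatorial properties of the weights `W u v = |A u v|²` of a connected `4`-cyclotomic
graph with adjacency matrix `A`. The diagonal of `W` records which vertices are charged. -/
structure IsWeightSystem {V : Type*} [Fintype V] (W : V → V → ℕ) : Prop where
  symm : ∀ u v, W u v = W v u
  row_sum : ∀ u, ∑ v, W u v = 4
  diag_le : ∀ v, W v v ≤ 1
  /-- Orthogonality of the rows `u` and `x` when only two terms of their inner product survive. -/
  transfer : ∀ u x c e, u ≠ x → c ≠ e → W u c = W u e → W u c ≠ 0 →
    (∀ w, w ≠ c → w ≠ e → W u w = 0 ∨ W w x = 0) → W c x = W e x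
  connected : ∀ (S : Set V) (z : V), z ∈ S → (∀ u ∈ S, ∀ v, W u v ≠ 0 → v ∈ S) → ∀ v, v ∈ S

theorem eq_zero_of_two_add_two {V : Type*} [Fintype V] {g : V → ℕ} (hg : ∑ v, g v = 4)
    {a b : V} (hab : a ≠ b) (ha : g a = 2) (hb : g b = 2) {x : V} (hxa : x ≠ a) (hxb : x ≠ b) :
    g x = 0 := by
  classical
  have h : ∑ v ∈ ({x, a, b} : Finset V), g v ≤ ∑ v, g v :=
    Finset.sum_le_sum_of_subset (Finset.subset_univ _)
  rw [Finset.sum_insert (by simp [hxa, hxb]), Finset.sum_pair hab] at h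
  omega

/-- A function with values in `ℕ` and sum `2` takes the value `2` once, or the value `1` twice. -/
theorem eq_two_or_eq_one_of_sum_eq_two {V : Type*} [Fintype V] {g : V → ℕ} (hg : ∑ v, g v = 2) :
    (∃ y, g y = 2 ∧ ∀ x, x ≠ y → g x = 0) ∨
      ∃ y y', y ≠ y' ∧ g y = 1 ∧ g y' = 1 ∧ ∀ x, x ≠ y → x ≠ y' → g x = 0 := by
  classical
  obtain ⟨y, -, hy⟩ : ∃ y ∈ Finset.univ, g y ≠ 0 :=
    Finset.exists_ne_zero_of_sum_ne_zero (by omega)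
  have h1 : g y + ∑ v ∈ Finset.univ.erase y, g v = 2 := by
    rw [Finset.add_sum_erase _ _ (Finset.mem_univ y), hg]
  by_cases hy2 : g y = 2
  · refine Or.inl ⟨y, hy2, fun x hx => ?_⟩
    exact (Finset.sum_eq_zero_iff.1 (by omega : ∑ v ∈ Finset.univ.erase y, g v = 0)) x (by simp [hx])
  · have h2 : ∑ v ∈ Finset.univ.erase y, g v = 1 := by omega
    obtain ⟨y', hm, hy'⟩ : ∃ y' ∈ Finset.univ.erase y, g y' ≠ 0 :=
      Finset.exists_ne_zero_of_sum_ne_zero (by omega)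
    have h3 : g y' + ∑ v ∈ (Finset.univ.erase y).erase y', g v = 1 := by
      rw [Finset.add_sum_erase _ _ hm, h2]
    refine Or.inr ⟨y, y', (Finset.ne_of_mem_erase hm).symm, by omega, by omega, fun x hx hx' => ?_⟩
    exact (Finset.sum_eq_zero_iff.1
      (by omega : ∑ v ∈ (Finset.univ.erase y).erase y', g v = 0)) x (by simp [hx, hx'])

/-! ### Ladders -/

/-- The columns `f 0, …, f n` form a ladder starting at the end vertex `z`: `z` has weight 2 edges
to the column `f 0` and no others, consecutive columns are completely joined by edges of weight 1,
and the vertices of `f 0, …, f (n - 1)` have no further edges or charges. Nothing is said about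
edges from the last column to itself or to vertices outside the ladder. Values `f i` with `n < i`
are irrelevant. -/
structure IsLadder {V : Type*} (W : V → V → ℕ) (z : V) (f : ℕ → Bool → V) (n : ℕ) : Prop where
  inj : ∀ i j s t, i ≤ n → j ≤ n → f i s = f j t → i = j ∧ s = t
  ne_end : ∀ i s, i ≤ n → f i s ≠ z
  end_row : ∀ x, W z x ≠ 0 → ∃ s, x = f 0 s
  end_weight : ∀ s, W z (f 0 s) = 2
  step : ∀ i s t, i < n → W (f i s) (f (i + 1) t) = 1
  inner_row : ∀ i s x, i < n → W (f i s) x ≠ 0 →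
    (i = 0 ∧ x = z) ∨ ∃ j t, j ≤ n ∧ x = f j t ∧ (i + 1 = j ∨ j + 1 = i)

/-- The vertices of a ladder whose neighbourhoods are completely known: the end vertex and the
vertices of all columns but the last. -/
def ladderInner {V : Type*} (z : V) (f : ℕ → Bool → V) (n : ℕ) (x : V) : Prop :=
  x = z ∨ ∃ i s, i < n ∧ x = f i s

namespace IsLadder

variable {V : Type*} {W : V → V → ℕ} {z : V} {f : ℕ → Bool → V} {n : ℕ}

theorem last_not_inner (hL : IsLadder W z f n) (s : Bool) : ¬ ladderInner z f n (f n s) := by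
  rintro (h | ⟨i, t, hi, h⟩)
  · exact hL.ne_end n s le_rfl h
  · have := (hL.inj n i s t le_rfl hi.le h).1
    omega

theorem weight_column_of_lt (hL : IsLadder W z f n) {i j : ℕ} (s t : Bool) (hi : i < n)
    (hj : j ≤ n) (hsymm : ∀ u v, W u v = W v u) :
    W (f i s) (f j t) = if i + 1 = j ∨ j + 1 = i then 1 else 0 := by
  split_ifs with h
  · rcases h with rfl | rfl
    · exact hL.step i s t hi
    · rw [hsymm]
      exact hL.step j t s (by omega)
  · by_contra h0
    rcases hL.inner_row i s _ hi h0 with ⟨-, h1⟩ | ⟨j', t', hj', h1, h2⟩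
    · exact hL.ne_end j t hj h1
    · obtain ⟨rfl, -⟩ := hL.inj _ _ _ _ hj hj' h1
      exact h h2

theorem weight_column (hL : IsLadder W z f n) {i j : ℕ} (s t : Bool) (hi : i ≤ n)
    (hj : j ≤ n) (hij : ¬ (i = n ∧ j = n)) (hsymm : ∀ u v, W u v = W v u) :
    W (f i s) (f j t) = if i + 1 = j ∨ j + 1 = i then 1 else 0 := by
  rcases hi.lt_or_eq with h | h
  · exact hL.weight_column_of_lt s t h hj hsymm
  · rw [hsymm, hL.weight_column_of_lt t s (by omega) hi hsymm]
    simp only [or_comm]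

theorem weight_end (hL : IsLadder W z f n) {i : ℕ} (s : Bool) (hi : i ≤ n) :
    W z (f i s) = if i = 0 then 2 else 0 := by
  split_ifs with h
  · subst h
    exact hL.end_weight s
  · by_contra h0
    obtain ⟨t, ht⟩ := hL.end_row _ h0
    exact h (hL.inj _ _ _ _ hi (Nat.zero_le _) ht).1

theorem weight_end_self (hL : IsLadder W z f n) : W z z = 0 := by
  by_contra h0
  obtain ⟨t, ht⟩ := hL.end_row _ h0
  exact hL.ne_end 0 t (Nat.zero_le _) ht.symm

/-- The two vertices of the last column have the same weights to all vertices outside the completed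
part, by orthogonality with the end vertex or with a vertex of the preceding column. -/
theorem twin [Fintype V] (hW : IsWeightSystem W) (hL : IsLadder W z f n) {x : V}
    (hx : ¬ ladderInner z f n x) : W (f n false) x = W (f n true) x := by
  have hne : f n false ≠ f n true := fun h => by
    simpa using (hL.inj _ _ _ _ le_rfl le_rfl h).2
  rcases n with _ | n
  · refine hW.transfer z x _ _ (fun h => hx (Or.inl h.symm)) hne ?_ ?_ fun w h1 h2 => Or.inl ?_
    · rw [hL.end_weight, hL.end_weight]
    · rw [hL.end_weight]
      simp
    · by_contra h0
      obtain ⟨s, rfl⟩ := hL.end_row w h0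
      cases s
      · exact h1 rfl
      · exact h2 rfl
  · refine hW.transfer (f n false) x _ _ (fun h => hx (Or.inr ⟨n, false, by omega, h.symm⟩)) hne
      ?_ ?_ fun w h1 h2 => ?_
    · rw [hL.step _ _ _ (by omega), hL.step _ _ _ (by omega)]
    · rw [hL.step _ _ _ (by omega)]
      simp
    · by_contra! h0
      obtain ⟨h3, h4⟩ := h0
      rcases hL.inner_row n false w (by omega) h3 with ⟨rfl, rfl⟩ | ⟨j, t, hj, rfl, h5 | h5⟩
      · obtain ⟨s, rfl⟩ := hL.end_row x h4
        exact hx (Or.inr ⟨0, s, by omega, rfl⟩)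
      · subst h5
        cases t
        · exact h1 rfl
        · exact h2 rfl
      · rcases hL.inner_row j t x (by omega) h4 with ⟨-, h6⟩ | ⟨i, s, hi, h6, h7⟩
        · exact hx (Or.inl h6)
        · exact hx (Or.inr ⟨i, s, by omega, h6⟩)

open Classical in
/-- A vertex of the last column has degree `2` left over for vertices outside the completed part. -/
theorem sum_outer [Fintype V] (hW : IsWeightSystem W) (hL : IsLadder W z f n) (s : Bool) :
    ∑ x, (if ladderInner z f n x then 0 else W (f n s) x) = 2 := by
  have hsum := hW.row_sum (f n s)
  rcases n with _ | n
  · have h : ∀ x, W (f 0 s) x =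
        (if ladderInner z f 0 x then 0 else W (f 0 s) x) + (if x = z then 2 else 0) := by
      intro x
      by_cases hx : x = z
      · subst hx
        rw [hW.symm, hL.end_weight]
        simp [ladderInner]
      · simp [ladderInner, hx]
    rw [Finset.sum_congr rfl fun x _ => h x, Finset.sum_add_distrib] at hsum
    simp only [Finset.sum_ite_eq', Finset.mem_univ, if_true] at hsum
    omega
  · have hne : f n false ≠ f n true := fun h => by
      simpa using (hL.inj _ _ _ _ (by omega) (by omega) h).2
    have h : ∀ x, W (f (n + 1) s) x =
        (if ladderInner z f (n + 1) x then 0 else W (f (n + 1) s) x) +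
          ((if x = f n false then 1 else 0) + (if x = f n true then 1 else 0)) := by
      intro x
      by_cases hx : ∃ t, x = f n t
      · obtain ⟨t, rfl⟩ := hx
        have hin : ladderInner z f (n + 1) (f n t) := Or.inr ⟨n, t, by omega, rfl⟩
        rw [if_pos hin, hW.symm, hL.step _ _ _ (by omega)]
        cases t
        · simp [hne]
        · simp [hne.symm]
      · rw [if_neg fun h => hx ⟨_, h⟩, if_neg fun h => hx ⟨_, h⟩]
        split_ifs with hin
        · rcases hin with rfl | ⟨i, t, hi, rfl⟩
          · rw [hW.symm, hL.weight_end _ le_rfl]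
            simp
          · rw [hL.weight_column _ _ le_rfl hi.le (by omega) hW.symm, if_neg]
            rintro (h | h)
            · omega
            · obtain rfl : i = n := by omega
              exact hx ⟨t, rfl⟩
        · rfl
    rw [Finset.sum_congr rfl fun x _ => h x, Finset.sum_add_distrib, Finset.sum_add_distrib] at hsum
    simp only [Finset.sum_ite_eq', Finset.mem_univ, if_true] at hsum
    omega

open Classical in
/-- The three ways in which the remaining degree of the last column can be spent. -/
theorem cases_next [Fintype V] (hW : IsWeightSystem W) (hL : IsLadder W z f n) :
    (∀ s x, ¬ ladderInner z f n x → W (f n s) x = if ∃ t, x = f n t then 1 else 0) ∨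
    (∃ y, ¬ ladderInner z f n y ∧ (∀ s, y ≠ f n s) ∧
      ∀ s x, ¬ ladderInner z f n x → W (f n s) x = if x = y then 2 else 0) ∨
    (∃ y : Bool → V, y false ≠ y true ∧ (∀ t, ¬ ladderInner z f n (y t)) ∧ (∀ s t, y t ≠ f n s) ∧
      ∀ s x, ¬ ladderInner z f n x → W (f n s) x = if ∃ t, x = y t then 1 else 0) := by
  -- By `twin` it is enough to describe the row of `f n false`.
  have htwin : ∀ s x, ¬ ladderInner z f n x → W (f n s) x = W (f n false) x := by
    intro s x hx
    cases s
    · rfl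
    · exact (hL.twin hW hx).symm
  have hne : f n false ≠ f n true := fun h => by
    simpa using (hL.inj _ _ _ _ le_rfl le_rfl h).2
  -- The edge inside the column is present exactly when its vertices are charged.
  have hce : W (f n false) (f n true) = W (f n false) (f n false) := by
    rw [hW.symm]
    exact htwin true _ (hL.last_not_inner false)
  have hdiag := hW.diag_le (f n false)
  have hval : ∀ y k, k ≠ 0 → (if ladderInner z f n y then 0 else W (f n false) y) = k →
      ¬ ladderInner z f n y ∧ W (f n false) y = k := by
    intro y k hk h
    split_ifs at h with hy
    · exact absurd h.symm hk
    · exact ⟨hy, h⟩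
  rcases eq_two_or_eq_one_of_sum_eq_two (hL.sum_outer hW false) with
    ⟨y, hy, h0⟩ | ⟨y, y', hyy, hy, hy', h0⟩
  · obtain ⟨hyo, hy2⟩ := hval y 2 (by simp) hy
    refine Or.inr (Or.inl ⟨y, hyo, fun s => ?_, fun s x hx => ?_⟩)
    · rintro rfl
      cases s <;> omega
    · rw [htwin s x hx]
      split_ifs with h
      · rw [h, hy2]
      · simpa [hx] using h0 x h
  · obtain ⟨hyo, hy1⟩ := hval y 1 (by simp) hy
    obtain ⟨hyo', hy1'⟩ := hval y' 1 (by simp) hy'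
    have hrow : ∀ s x, ¬ ladderInner z f n x →
        W (f n s) x = if x = y ∨ x = y' then 1 else 0 := by
      intro s x hx
      rw [htwin s x hx]
      split_ifs with h
      · rcases h with rfl | rfl <;> assumption
      · push Not at h
        simpa [hx] using h0 x h.1 h.2
    by_cases hc : W (f n false) (f n false) = 0
    · refine Or.inr (Or.inr ⟨fun t => if t then y' else y, by simpa using hyy, ?_, ?_, ?_⟩)
      · intro t
        cases t <;> simpa
      · intro s t
        cases t <;> cases s <;> simp only [if_true, Bool.false_eq_true, if_false] <;>
          rintro rfl <;> omega
      · intro s x hx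
        simpa using hrow s x hx
    · left
      have h1 : ∀ s, f n s = y ∨ f n s = y' := by
        intro s
        by_contra h
        have := hrow false _ (hL.last_not_inner s)
        rw [if_neg h] at this
        cases s <;> omega
      intro s x hx
      rw [hrow s x hx]
      congr 1
      -- The vertices `y`, `y'` are those of the column itself, in one order or the other.
      rw [eq_iff_iff, Bool.exists_bool]
      rcases h1 false with h | h <;> rcases h1 true with h' | h' <;>
        first
        | exact absurd (h.trans h'.symm) hne
        | (rw [h, h']; try exact or_comm)

open Classical in
/-- If the vertices of the last column are charged and joined to each other, the ladder is the
whole graph. -/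
theorem surjective_of_charged [Fintype V] (hW : IsWeightSystem W) (hL : IsLadder W z f n)
    (h : ∀ s x, ¬ ladderInner z f n x → W (f n s) x = if ∃ t, x = f n t then 1 else 0) (v : V) :
    v = z ∨ ∃ i s, i ≤ n ∧ v = f i s := by
  refine hW.connected {v | v = z ∨ ∃ i s, i ≤ n ∧ v = f i s} z (Or.inl rfl) ?_ v
  rintro u (rfl | ⟨i, s, hi, rfl⟩) v hv
  · obtain ⟨s, rfl⟩ := hL.end_row v hv
    exact Or.inr ⟨0, s, Nat.zero_le _, rfl⟩
  · rcases hi.lt_or_eq with hi | rfl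
    · rcases hL.inner_row i s v hi hv with ⟨-, h1⟩ | ⟨j, t, hj, h1, -⟩
      · exact Or.inl h1
      · exact Or.inr ⟨j, t, hj, h1⟩
    · by_cases hin : ladderInner z f i v
      · rcases hin with h1 | ⟨j, t, hj, h1⟩
        · exact Or.inl h1
        · exact Or.inr ⟨j, t, hj.le, h1⟩
      · rw [h s v hin] at hv
        obtain ⟨t, ht⟩ : ∃ t, v = f i t := by
          by_contra h1
          exact hv (if_neg h1)
        exact Or.inr ⟨i, t, le_rfl, ht⟩

/-- A vertex joined to the last column by weight 2 edges has no other edges and is uncharged. -/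
theorem eq_zero_of_top [Fintype V] (hW : IsWeightSystem W) (hL : IsLadder W z f n) {y : V}
    (h : ∀ s, W (f n s) y = 2) {x : V} (hx : ∀ s, x ≠ f n s) : W y x = 0 := by
  have hne : f n false ≠ f n true := fun h => by
    simpa using (hL.inj _ _ _ _ le_rfl le_rfl h).2
  exact eq_zero_of_two_add_two (hW.row_sum y) hne (by rw [hW.symm, h]) (by rw [hW.symm, h])
    (hx _) (hx _)

open Classical in
/-- If both vertices of the last column have a weight 2 edge to `y`, the ladder and `y` are the
whole graph. -/
theorem surjective_of_top [Fintype V] (hW : IsWeightSystem W) (hL : IsLadder W z f n) {y : V}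
    (hy : ¬ ladderInner z f n y)
    (h : ∀ s x, ¬ ladderInner z f n x → W (f n s) x = if x = y then 2 else 0) (v : V) :
    v = z ∨ v = y ∨ ∃ i s, i ≤ n ∧ v = f i s := by
  refine hW.connected {v | v = z ∨ v = y ∨ ∃ i s, i ≤ n ∧ v = f i s} z (Or.inl rfl) ?_ v
  rintro u (rfl | rfl | ⟨i, s, hi, rfl⟩) v hv
  · obtain ⟨s, rfl⟩ := hL.end_row v hv
    exact Or.inr (Or.inr ⟨0, s, Nat.zero_le _, rfl⟩)
  · by_contra hv'
    refine hv (hL.eq_zero_of_top hW (fun s => by rw [h s _ hy, if_pos rfl]) fun s hs => ?_)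
    exact hv' (Or.inr (Or.inr ⟨n, s, le_rfl, hs⟩))
  · rcases hi.lt_or_eq with hi | rfl
    · rcases hL.inner_row i s v hi hv with ⟨-, h1⟩ | ⟨j, t, hj, h1, -⟩
      · exact Or.inl h1
      · exact Or.inr (Or.inr ⟨j, t, hj, h1⟩)
    · by_cases hin : ladderInner z f i v
      · rcases hin with h1 | ⟨j, t, hj, h1⟩
        · exact Or.inl h1
        · exact Or.inr (Or.inr ⟨j, t, hj.le, h1⟩)
      · rw [h s v hin] at hv
        exact Or.inr (Or.inl (by_contra fun h1 => hv (if_neg h1)))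

open Classical in
/-- Two new vertices joined to the last column by weight 1 edges form another column. -/
theorem extend [Fintype V] (hW : IsWeightSystem W) (hL : IsLadder W z f n) {y : Bool → V}
    (hyy : y false ≠ y true) (hyo : ∀ t, ¬ ladderInner z f n (y t)) (hyl : ∀ s t, y t ≠ f n s)
    (h : ∀ s x, ¬ ladderInner z f n x →
      W (f n s) x = if ∃ t, x = y t then 1 else 0) :
    IsLadder W z (Function.update f (n + 1) y) (n + 1) := by
  have hold : ∀ i, i ≤ n → Function.update f (n + 1) y i = f i := fun i hi =>
    Function.update_of_ne (by omega) _ _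
  have hnew : Function.update f (n + 1) y (n + 1) = y := Function.update_self _ _ _
  have hyf : ∀ i s t, i ≤ n → f i s ≠ y t := by
    intro i s t hi hit
    rcases hi.lt_or_eq with hi | rfl
    · exact hyo t (Or.inr ⟨i, s, hi, hit.symm⟩)
    · exact hyl s t hit.symm
  refine ⟨?_, ?_, ?_, ?_, ?_, ?_⟩
  · intro i j s t hi hj hij
    rcases Nat.le_succ_iff.1 hi with hi | rfl <;> rcases Nat.le_succ_iff.1 hj with hj | rfl
    · rw [hold i hi, hold j hj] at hij
      exact hL.inj i j s t hi hj hij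
    · rw [hold i hi, hnew] at hij
      exact absurd hij (hyf i s t hi)
    · rw [hold j hj, hnew] at hij
      exact absurd hij.symm (hyf j t s hj)
    · rw [hnew] at hij
      refine ⟨rfl, ?_⟩
      cases s <;> cases t <;> first | rfl | exact absurd hij hyy | exact absurd hij.symm hyy
  · intro i s hi
    rcases Nat.le_succ_iff.1 hi with hi | rfl
    · rw [hold i hi]
      exact hL.ne_end i s hi
    · rw [hnew]
      exact fun hz => hyo s (Or.inl hz)
  · rw [hold 0 (Nat.zero_le _)]
    exact hL.end_row
  · rw [hold 0 (Nat.zero_le _)]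
    exact hL.end_weight
  · intro i s t hi
    rcases (Nat.lt_succ_iff.1 hi).lt_or_eq with hi | rfl
    · rw [hold i hi.le, hold (i + 1) hi]
      exact hL.step i s t hi
    · rw [hold i le_rfl, hnew, h s _ (hyo t), if_pos ⟨t, rfl⟩]
  · intro i s x hi hx
    rw [hold i (by omega)] at hx
    rcases (Nat.lt_succ_iff.1 hi).lt_or_eq with hi | rfl
    · rcases hL.inner_row i s x hi hx with h1 | ⟨j, t, hj, h1, h2⟩
      · exact Or.inl h1
      · exact Or.inr ⟨j, t, by omega, by rw [hold j hj, h1], h2⟩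
    · by_cases hin : ladderInner z f i x
      · rcases hin with rfl | ⟨j, t, hj, rfl⟩
        · rw [hW.symm, hL.weight_end _ le_rfl] at hx
          exact Or.inl ⟨by_contra fun h1 => hx (if_neg h1), rfl⟩
        · rw [hL.weight_column _ _ le_rfl hj.le (by omega) hW.symm] at hx
          refine Or.inr ⟨j, t, by omega, by rw [hold j hj.le], ?_⟩
          exact by_contra fun h1 => hx (if_neg h1)
      · rw [h s x hin] at hx
        obtain ⟨t, ht⟩ : ∃ t, x = y t := by
          by_contra h1
          exact hx (if_neg h1)
        exact Or.inr ⟨i + 1, t, le_rfl, by rw [hnew, ht], Or.inl rfl⟩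

theorem lt_card [Fintype V] (hL : IsLadder W z f n) : n < Fintype.card V := by
  have h := Fintype.card_le_of_injective (fun i : Fin (n + 1) => f i false) fun i j hij =>
    Fin.ext (hL.inj _ _ _ _ (by omega) (by omega) hij).1
  simpa using h

end IsLadder

/-- The vertex `z` and the two vertices joined to it by weight 2 edges form the shortest ladder. -/
theorem IsWeightSystem.isLadder_zero {V : Type*} [Fintype V] {W : V → V → ℕ}
    (hW : IsWeightSystem W) {z a b : V} (hab : a ≠ b) (ha : W z a = 2) (hb : W z b = 2) :
    IsLadder W z (fun _ s => if s then b else a) 0 := by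
  have hz := hW.diag_le z
  refine ⟨?_, ?_, ?_, ?_, fun _ _ _ h => absurd h (Nat.not_lt_zero _),
    fun _ _ _ h => absurd h (Nat.not_lt_zero _)⟩
  · intro i j s t hi hj h
    refine ⟨by omega, ?_⟩
    cases s <;> cases t <;> simp_all [eq_comm]
  · intro i s _
    cases s <;> simp only [if_true, Bool.false_eq_true, if_false] <;> rintro rfl <;> omega
  · intro x hx
    by_contra! h
    exact hx (eq_zero_of_two_add_two (hW.row_sum z) hab ha hb (h false) (h true))
  · intro s
    cases s <;> simpa

/-! ### Recognising the two forms -/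

/-- `W` is the system of weights of the form `F`, up to the naming of the vertices. -/
def HasForm {V U : Type*} (W : V → V → ℕ) (F : GraphForm U) : Prop :=
  ∃ φ : U → V, Function.Bijective φ ∧
    (∀ p q, p ≠ q → W (φ p) (φ q) = F.weight p q) ∧ ∀ p, W (φ p) (φ p) ≠ 0 ↔ F.charged p

namespace IsLadder

variable {V : Type*} {W : V → V → ℕ} {z : V} {f : ℕ → Bool → V} {n : ℕ}

open Classical in
/-- In `formC` the charged column is the first one, so the columns are numbered backwards. -/
theorem hasForm_formC [Fintype V] (hW : IsWeightSystem W) (hL : IsLadder W z f n)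
    (h : ∀ s x, ¬ ladderInner z f n x →
      W (f n s) x = if ∃ t, x = f n t then 1 else 0) :
    HasForm W (formC (n + 1)) := by
  have hll : ∀ s t, W (f n s) (f n t) = 1 := fun s t => by
    rw [h s _ (hL.last_not_inner t), if_pos ⟨t, rfl⟩]
  have hle : ∀ i : ℕ, n - i ≤ n := fun i => Nat.sub_le _ _
  refine ⟨Sum.elim (fun p => f (n - p.1) p.2) (fun _ => z), ⟨?_, ?_⟩, ?_, ?_⟩
  · rintro (⟨i, s⟩ | _) (⟨j, t⟩ | _) hpq
    · obtain ⟨h1, rfl⟩ := hL.inj _ _ _ _ (hle _) (hle _) hpq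
      obtain rfl : i = j := Fin.ext (by simp only at h1; omega)
      rfl
    · exact absurd hpq (hL.ne_end _ _ (hle _))
    · exact absurd hpq.symm (hL.ne_end _ _ (hle _))
    · rfl
  · intro v
    rcases hL.surjective_of_charged hW h v with rfl | ⟨i, s, hi, rfl⟩
    · exact ⟨.inr (), rfl⟩
    · refine ⟨.inl (⟨n - i, by omega⟩, s), ?_⟩
      simp [Nat.sub_sub_self hi]
  · rintro (⟨i, s⟩ | _) (⟨j, t⟩ | _) hpq
    · have hi := i.2
      have hj := j.2
      simp only [Sum.elim_inl, formC]
      by_cases h0 : (i : ℕ) = 0 ∧ (j : ℕ) = 0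
      · have hst : s ≠ t := by
          rintro rfl
          exact hpq (by rw [Fin.ext (h0.1.trans h0.2.symm)])
        rw [h0.1, h0.2, Nat.sub_zero, hll]
        simp [hst]
      · rw [hL.weight_column _ _ (hle _) (hle _) (by omega) hW.symm]
        congr 1
        rw [eq_iff_iff]
        omega
    · have hi := i.2
      simp only [Sum.elim_inl, Sum.elim_inr, formC]
      rw [hW.symm, hL.weight_end _ (hle _)]
      congr 1
      rw [eq_iff_iff]
      omega
    · have hj := j.2
      simp only [Sum.elim_inl, Sum.elim_inr, formC]
      rw [hL.weight_end _ (hle _)]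
      congr 1
      rw [eq_iff_iff]
      omega
    · exact absurd rfl hpq
  · rintro (⟨i, s⟩ | _)
    · have hi := i.2
      simp only [Sum.elim_inl, formC]
      by_cases h0 : (i : ℕ) = 0
      · rw [h0, Nat.sub_zero, hll]
        simp
      · rw [hL.weight_column _ _ (hle _) (hle _) (by omega) hW.symm, if_neg (by omega)]
        simp [h0]
    · simp [formC, hL.weight_end_self]

open Classical in
theorem hasForm_formT [Fintype V] (hW : IsWeightSystem W) (hL : IsLadder W z f n) {y : V}
    (hyo : ¬ ladderInner z f n y) (hyl : ∀ s, y ≠ f n s)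
    (h : ∀ s x, ¬ ladderInner z f n x →
      W (f n s) x = if x = y then 2 else 0) :
    HasForm W (formT (n + 2)) := by
  have hyz : y ≠ z := fun hy => hyo (Or.inl hy)
  have hyf : ∀ i s, i ≤ n → f i s ≠ y := by
    intro i s hi hit
    rcases hi.lt_or_eq with hi | rfl
    · exact hyo (Or.inr ⟨i, s, hi, hit.symm⟩)
    · exact hyl s hit.symm
  have hll : ∀ s t, W (f n s) (f n t) = 0 := fun s t => by
    rw [h s _ (hL.last_not_inner t), if_neg (hyl t).symm]
  have hcol : ∀ i j s t, i ≤ n → j ≤ n →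
      W (f i s) (f j t) = if i + 1 = j ∨ j + 1 = i then 1 else 0 := by
    intro i j s t hi hj
    by_cases hij : i = n ∧ j = n
    · obtain ⟨rfl, rfl⟩ := hij
      rw [hll, if_neg (by omega)]
    · exact hL.weight_column s t hi hj hij hW.symm
  have htop : ∀ s, W (f n s) y = 2 := fun s => by rw [h s _ hyo, if_pos rfl]
  have hycol : ∀ i s, i ≤ n → W (f i s) y = if i + 1 = n + 1 then 2 else 0 := by
    intro i s hi
    split_ifs with h1
    · obtain rfl : i = n := by omega
      exact htop s
    · rw [hW.symm]
      refine hL.eq_zero_of_top hW htop fun t ht => h1 ?_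
      rw [(hL.inj _ _ _ _ hi le_rfl ht).1]
  have hyz0 : W y z = 0 := hL.eq_zero_of_top hW htop fun t => (hL.ne_end n t le_rfl).symm
  have hyy0 : W y y = 0 := hL.eq_zero_of_top hW htop hyl
  have hlt : ∀ i : Fin (n + 2 - 1), (i : ℕ) ≤ n := fun i => by have := i.2; omega
  refine ⟨Sum.elim (fun p => f p.1 p.2) (fun t => if t then y else z), ⟨?_, ?_⟩, ?_, ?_⟩
  · rintro (⟨i, s⟩ | _ | _) (⟨j, t⟩ | _ | _) hpq
    · obtain ⟨h1, rfl⟩ := hL.inj _ _ _ _ (hlt i) (hlt j) hpq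
      rw [Fin.ext h1]
    · exact absurd hpq (hL.ne_end _ _ (hlt i))
    · exact absurd hpq (hyf _ _ (hlt i))
    · exact absurd hpq.symm (hL.ne_end _ _ (hlt j))
    · rfl
    · exact absurd hpq.symm hyz
    · exact absurd hpq.symm (hyf _ _ (hlt j))
    · exact absurd hpq hyz
    · rfl
  · intro v
    rcases hL.surjective_of_top hW hyo h v with rfl | rfl | ⟨i, s, hi, rfl⟩
    · exact ⟨.inr false, rfl⟩
    · exact ⟨.inr true, rfl⟩
    · exact ⟨.inl (⟨i, by omega⟩, s), rfl⟩
  · rintro (⟨i, s⟩ | _ | _) (⟨j, t⟩ | _ | _) hpq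
    · exact hcol _ _ _ _ (hlt i) (hlt j)
    · exact (hW.symm _ _).trans (hL.weight_end _ (hlt i))
    · exact hycol _ _ (hlt i)
    · exact hL.weight_end _ (hlt j)
    · exact absurd rfl hpq
    · exact (hW.symm _ _).trans hyz0
    · exact (hW.symm _ _).trans (hycol _ _ (hlt j))
    · exact hyz0
    · exact absurd rfl hpq
  · rintro (⟨i, s⟩ | _ | _)
    · simp [formT, hcol _ _ _ _ (hlt i) (hlt i)]
    · simp [formT, hL.weight_end_self]
    · simp [formT, hyy0]

end IsLadder

theorem IsWeightSystem.hasForm {V : Type*} [Fintype V] {W : V → V → ℕ} (hW : IsWeightSystem W)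
    {z a b : V} (hab : a ≠ b) (ha : W z a = 2) (hb : W z b = 2) :
    (∃ k, 2 ≤ k ∧ HasForm W (formT k)) ∨ ∃ k, 1 ≤ k ∧ HasForm W (formC k) := by
  by_contra hno
  -- If neither form occurs, the ladder can be extended indefinitely.
  have hall : ∀ n, ∃ f, IsLadder W z f n := by
    intro n
    induction n with
    | zero => exact ⟨_, hW.isLadder_zero hab ha hb⟩
    | succ n ih =>
      obtain ⟨f, hL⟩ := ih
      rcases hL.cases_next hW with h | ⟨y, hyo, hyl, h⟩ | ⟨y, hyy, hyo, hyl, h⟩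
      · exact absurd (Or.inr ⟨n + 1, by omega, hL.hasForm_formC hW h⟩) hno
      · exact absurd (Or.inl ⟨n + 2, by omega, hL.hasForm_formT hW hyo hyl h⟩) hno
      · exact ⟨_, hL.extend hW hyy hyo hyl h⟩
  obtain ⟨f, hL⟩ := hall (Fintype.card V)
  exact lt_irrefl _ hL.lt_card

/-! ### The weights of a four-cyclotomic graph -/

namespace LGraph

variable {d : ℤ} {V : Type*}

theorem normSq_of_mem_labelsOfNorm {n : ℕ} {x : ℂ} (h : x ∈ labelsOfNorm d n) :
    Complex.normSq x = n := by
  have h2 := h.2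
  rw [Complex.star_def, Complex.mul_conj] at h2
  exact_mod_cast h2

theorem normSq_diag (G : LGraph d V) (v : V) :
    Complex.normSq (G.adj v v) = if G.adj v v = 0 then 0 else 1 := by
  rcases G.charge_mem v with h | h | h <;> simp [h]

theorem exists_weight (G : LGraph d V) (u v : V) :
    ∃ n : ℕ, Complex.normSq (G.adj u v) = n := by
  by_cases huv : u = v
  · subst huv
    rw [G.normSq_diag]
    split_ifs
    · exact ⟨0, by simp⟩
    · exact ⟨1, by simp⟩
  · rcases G.label_mem u v huv with (((h | h) | h) | h) | h
    · exact ⟨0, by rw [Set.mem_singleton_iff.1 h]; simp⟩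
    all_goals exact ⟨_, normSq_of_mem_labelsOfNorm h⟩

/-- The weight of the edge between `u` and `v` as a natural number; for `u = v` it is `1` if the
vertex is charged and `0` otherwise. -/
noncomputable def weight (G : LGraph d V) (u v : V) : ℕ := (G.exists_weight u v).choose

theorem normSq_adj (G : LGraph d V) (u v : V) : Complex.normSq (G.adj u v) = G.weight u v :=
  (G.exists_weight u v).choose_spec

theorem weight_eq_zero_iff (G : LGraph d V) (u v : V) : G.weight u v = 0 ↔ G.adj u v = 0 := by
  rw [← Complex.normSq_eq_zero, G.normSq_adj, Nat.cast_eq_zero]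

theorem weight_symm (G : LGraph d V) (u v : V) : G.weight u v = G.weight v u := by
  have h : Complex.normSq (G.adj u v) = Complex.normSq (G.adj v u) := by
    rw [← G.isHermitian.apply u v, Complex.star_def, Complex.normSq_conj]
  rw [G.normSq_adj, G.normSq_adj] at h
  exact_mod_cast h

theorem IsEdgeOfWeight.weight_eq {G : LGraph d V} {n : ℕ} {u v : V} (h : G.IsEdgeOfWeight n u v) :
    G.weight u v = n := by
  have h1 := normSq_of_mem_labelsOfNorm h.2
  rw [G.normSq_adj] at h1
  exact_mod_cast h1

theorem weightedDegree_eq_sum [Fintype V] (G : LGraph d V) (v : V) :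
    G.weightedDegree v = ∑ u, Complex.normSq (G.adj v u) := by
  classical
  rw [weightedDegree, ← Finset.sum_filter_add_sum_filter_not Finset.univ (fun u => u ≠ v)]
  congr 1
  simp [Finset.sum_filter, G.normSq_diag]

/-- The diagonal of `4 - A * A` vanishes, and its eigenvalues are nonnegative, so it is zero. -/
theorem adj_mul_adj [Fintype V] [DecidableEq V] (G : LGraph d V) (h4 : G.IsFourCyclotomic) :
    G.adj * G.adj = (4 : ℂ) • (1 : Matrix V V ℂ) := by
  have hA := G.isHermitian
  have hdiag : ∀ v, (G.adj * G.adj) v v = 4 := by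
    intro v
    have h := h4.2 v
    rw [G.weightedDegree_eq_sum] at h
    rw [Matrix.mul_apply]
    have h' : ∀ u, G.adj v u * G.adj u v = (Complex.normSq (G.adj v u) : ℂ) := by
      intro u
      rw [← hA.apply u v, Complex.star_def, Complex.mul_conj]
    rw [Finset.sum_congr rfl fun u _ => h' u, ← Complex.ofReal_sum, h]
    norm_num
  have hspec := hA.spectral_theorem
  set U := hA.eigenvectorUnitary with hU
  set D : Matrix V V ℂ := Matrix.diagonal (RCLike.ofReal ∘ hA.eigenvalues) with hD
  have hsq : G.adj * G.adj = Unitary.conjStarAlgAut ℂ _ U (D * D) := by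
    rw [map_mul, ← hspec]
  have htrace : ∑ i, (4 - hA.eigenvalues i ^ 2) = 0 := by
    have h1 : (G.adj * G.adj).trace = ∑ _i : V, (4 : ℂ) :=
      Finset.sum_congr rfl fun v _ => hdiag v
    have h2 : (G.adj * G.adj).trace = (D * D).trace := by
      rw [hsq, Unitary.conjStarAlgAut_apply, Matrix.trace_mul_comm, ← mul_assoc,
        Unitary.coe_star_mul_self, one_mul]
    have h3 : (D * D).trace = ∑ i, ((hA.eigenvalues i ^ 2 : ℝ) : ℂ) := by
      rw [hD, Matrix.diagonal_mul_diagonal, Matrix.trace_diagonal]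
      refine Finset.sum_congr rfl fun i _ => ?_
      simp [sq]
    rw [h1, h3] at h2
    have h5 : ∑ _i : V, (4 : ℝ) = ∑ i, hA.eigenvalues i ^ 2 := by exact_mod_cast h2
    rw [Finset.sum_sub_distrib, h5, sub_self]
  have heig : ∀ i, hA.eigenvalues i ^ 2 = 4 := by
    intro i
    have h0 := (Finset.sum_eq_zero_iff_of_nonneg fun i _ => by
      obtain ⟨h1, h2⟩ := h4.1 i
      nlinarith).1 htrace i (Finset.mem_univ i)
    linarith
  have hDD : D * D = (4 : ℂ) • (1 : Matrix V V ℂ) := by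
    rw [hD, Matrix.diagonal_mul_diagonal, Matrix.smul_one_eq_diagonal]
    congr 1
    funext i
    have h : ((hA.eigenvalues i : ℝ) : ℂ) ^ 2 = 4 := by exact_mod_cast heig i
    exact (sq _).symm.trans h
  rw [hsq, hDD, map_smul, map_one]

theorem isWeightSystem [Fintype V] [DecidableEq V] (G : LGraph d V) (hconn : G.Connected)
    (h4 : G.IsFourCyclotomic) : IsWeightSystem G.weight where
  symm := G.weight_symm
  row_sum u := by
    have h := h4.2 u
    rw [G.weightedDegree_eq_sum, Finset.sum_congr rfl fun v _ => G.normSq_adj u v] at h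
    exact_mod_cast h
  diag_le v := by
    have h := G.normSq_diag v
    rw [G.normSq_adj] at h
    split_ifs at h
    · have : G.weight v v = 0 := by exact_mod_cast h
      omega
    · have : G.weight v v = 1 := by exact_mod_cast h
      omega
  transfer u x c e hux hce huce hne hother := by
    have h0 : (G.adj * G.adj) u x = 0 := by
      rw [G.adj_mul_adj h4]
      simp [hux]
    rw [Matrix.mul_apply, ← Finset.sum_subset (Finset.subset_univ {c, e}), Finset.sum_pair hce] at h0
    · have h1 : Complex.normSq (G.adj u c * G.adj c x) = Complex.normSq (G.adj u e * G.adj e x) := by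
        rw [eq_neg_of_add_eq_zero_left h0, Complex.normSq_neg]
      simp only [Complex.normSq_mul, G.normSq_adj] at h1
      have h2 : G.weight u c * G.weight c x = G.weight u e * G.weight e x := by exact_mod_cast h1
      rw [← huce] at h2
      exact Nat.eq_of_mul_eq_mul_left (Nat.pos_of_ne_zero hne) h2
    · intro w _ hw
      simp only [Finset.mem_insert, Finset.mem_singleton, not_or] at hw
      rcases hother w hw.1 hw.2 with h | h <;> rw [G.weight_eq_zero_iff] at h <;> simp [h]
  connected S z hz hS v := by
    obtain ⟨p⟩ := hconn.preconnected z v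
    induction p with
    | nil => exact hz
    | cons hadj _ ih => exact ih (hS _ hz _ fun h => hadj.2 ((G.weight_eq_zero_iff _ _).1 h))

theorem isOfForm_of_hasForm (G : LGraph d V) {U : Type*} {F : GraphForm U}
    (h : HasForm G.weight F) : G.IsOfForm F := by
  obtain ⟨φ, hφ, hw, hc⟩ := h
  have hφe : ∀ v, φ ((Equiv.ofBijective φ hφ).symm v) = v := (Equiv.ofBijective φ hφ).apply_symm_apply
  refine ⟨(Equiv.ofBijective φ hφ).symm, fun u v huv => ?_, fun v => ?_⟩
  · rw [← hw _ _ fun h => huv ((Equiv.ofBijective φ hφ).symm.injective h), hφe, hφe, G.normSq_adj]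
  · rw [← hc, hφe, Ne, Ne, G.weight_eq_zero_iff]

end LGraph

theorem mainTheorem7 (d : ℤ) (hd : d = -2 ∨ d = -7 ∨ d = -11 ∨ d = -15)
    {V : Type*} [Fintype V] [DecidableEq V] (G : LGraph d V)
    (hconn : G.Connected) (h4 : G.IsFourCyclotomic)
    (hex : ∃ u v : V, G.IsEdgeOfWeight 2 u v)
    (hpairs : G.WeightTwoEdgesInPairs) :
    (∃ k : ℕ, 2 ≤ k ∧ G.IsOfForm (formT k)) ∨ (∃ k : ℕ, 1 ≤ k ∧ G.IsOfForm (formC k)) := by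
  have hW := G.isWeightSystem hconn h4
  obtain ⟨z, a, b, hab, ha, hb⟩ :
      ∃ z a b, a ≠ b ∧ G.weight z a = 2 ∧ G.weight z b = 2 := by
    obtain ⟨u, v, huv⟩ := hex
    obtain ⟨w, hwu, hwv, h | h⟩ := hpairs u v huv
    · exact ⟨u, v, w, hwv.symm, huv.weight_eq, h.weight_eq⟩
    · exact ⟨v, u, w, hwu.symm, by rw [G.weight_symm, huv.weight_eq], h.weight_eq⟩
  rcases hW.hasForm hab ha hb with ⟨k, hk, h⟩ | ⟨k, hk, h⟩
  · exact Or.inl ⟨k, hk, G.isOfForm_of_hasForm h⟩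
  · exact Or.inr ⟨k, hk, G.isOfForm_of_hasForm h⟩
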